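/- Let $A,B,C$ be $3$-dimensional complex vector spaces and let $X=\mathbb{P}A\times\mathbb{P}B\times\mathbb{P}C\subseteq\mathbb{P}(A\otimes B\otimes C)$ be the Segre variety of (classes of) rank one tensors. Let $\sigma_4(X)\subseteq\mathbb{P}(A\otimes B\otimes C)$ be its fourth secant variety, that is, the Zariski closure of the set of points lying in the span of four points of $X$. For a projective variety $S\subseteq \mathbb{P}^N$ and a point $p\in S$, let $\mathrm{mult}_S(p)$ denote the multiplicity of $p$ in $S$, i.e. the degree of the (scheme-theoretic) tangent cone to $S$ at $p$; here the homogeneous ideal of the tangent cone is generated by the lowest-degree homogeneous parts of the Taylor expansions at (a representative of) $p$ of the polynomials in the ideal of $S$, and the degree of a projective scheme is $d!$ times the leading coefficient of its Hilbert polynomial, where $d$ is the degree of that polynomial. (If $S$ is a hypersurface with reduced equation $f$, this is the order of vanishing of $f$ at $p$.) Then for every $z\in X$, \[ \mathrm{mult}_{\sigma_4(X)}(z)\le 7 . \] -/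

import Mathlib

open scoped LinearAlgebra.Projectivization TensorProduct

noncomputable section

namespace SecantMult

section ProjectiveVarieties

variable {σ V : Type*} [AddCommGroup V] [Module ℂ V]

/-- The punctured affine cone over a subset `Y` of `ℙ(V)`, written in the linear coordinates on `V`
given by the basis `β`: all coordinate vectors of nonzero `v` with `[v] ∈ Y`. -/
def coneCoords (β : Module.Basis σ ℂ V) (Y : Set (ℙ ℂ V)) : Set (σ → ℂ) :=
  {x | ∃ (v : V) (hv : v ≠ 0), Projectivization.mk ℂ v hv ∈ Y ∧ x = fun i => β.repr v i}

/-- The ideal `I(Y)` of `Y ⊆ ℙ(V)` in the polynomial ring in the coordinates given by `β`: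
polynomials vanishing at every representative of every point of `Y`. (Since `coneCoords β Y` is
stable under scaling by `ℂˣ`, this is automatically a homogeneous ideal.) -/
def idealOf (β : Module.Basis σ ℂ V) (Y : Set (ℙ ℂ V)) : Ideal (MvPolynomial σ ℂ) :=
  MvPolynomial.vanishingIdeal ℂ (coneCoords β Y)

/-- The Zariski closure of `Y ⊆ ℙ(V)`. -/
def zariskiClosure (β : Module.Basis σ ℂ V) (Y : Set (ℙ ℂ V)) : Set (ℙ ℂ V) :=
  {p | coneCoords β {p} ⊆ MvPolynomial.zeroLocus ℂ (idealOf β Y)}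

/-- `σ_r°(X)`: the points lying in the projective span of `r` (not necessarily distinct) points
of `X`, that is, the points of `X`-rank at most `r`. -/
def rankLE (X : Set (ℙ ℂ V)) (r : ℕ) : Set (ℙ ℂ V) :=
  {p | ∃ z : Fin r → ℙ ℂ V, (∀ i, z i ∈ X) ∧ p.submodule ≤ ⨆ i, (z i).submodule}

/-- The `r`-th secant variety `σ_r(X)`: the Zariski closure of `σ_r°(X)`. -/
def secantVariety (β : Module.Basis σ ℂ V) (X : Set (ℙ ℂ V)) (r : ℕ) : Set (ℙ ℂ V) :=
  zariskiClosure β (rankLE X r)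

/-- The Taylor expansion `f(x + ·)` of a polynomial `f` at the point `x`. -/
def translate (x : σ → ℂ) (f : MvPolynomial σ ℂ) : MvPolynomial σ ℂ :=
  MvPolynomial.aeval (fun i => MvPolynomial.X i + MvPolynomial.C (x i)) f

/-- The homogeneous ideal of the (scheme-theoretic) projective tangent cone to `S ⊆ ℙ(V)` at `p`:
it is generated by the lowest-degree homogeneous parts, at a representative of `p`, of the elements
of `I(S)`. In coordinates with `p = (1, 0, …, 0)` these are the lowest forms in `x₁, …, x_N` of the
dehomogenized equations of `S`, considered as equations in `ℙ(V)`. -/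
def tangentConeIdeal (β : Module.Basis σ ℂ V) (S : Set (ℙ ℂ V)) (p : ℙ ℂ V) :
    Ideal (MvPolynomial σ ℂ) :=
  Ideal.span {g | ∃ f ∈ idealOf β S, ∃ k : ℕ,
    (∀ j < k, MvPolynomial.homogeneousComponent j (translate (fun i => β.repr p.rep i) f) = 0) ∧
    g = MvPolynomial.homogeneousComponent k (translate (fun i => β.repr p.rep i) f)}

/-- The Hilbert function `k ↦ dim (ℂ[x] / J)_k` of a homogeneous ideal `J`. -/
def hilbertFunction (J : Ideal (MvPolynomial σ ℂ)) (k : ℕ) : ℕ :=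
  Module.finrank ℂ (MvPolynomial.homogeneousSubmodule σ ℂ k ⧸
    (J.restrictScalars ℂ).comap (MvPolynomial.homogeneousSubmodule σ ℂ k).subtype)

/-- The nonempty closed subscheme of projective space with homogeneous ideal `J` has degree `e`:
its Hilbert polynomial `P` is nonzero and has leading coefficient `e / (deg P)!`. -/
def HasDegree (J : Ideal (MvPolynomial σ ℂ)) (e : ℕ) : Prop :=
  ∃ P : Polynomial ℚ, P ≠ 0 ∧
    (∀ᶠ k : ℕ in Filter.atTop, (hilbertFunction J k : ℚ) = P.eval (k : ℚ)) ∧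
    (e : ℚ) = (P.natDegree.factorial : ℚ) * P.leadingCoeff

/-- The multiplicity of `p` in `S`, defined as the degree of the tangent cone to `S` at `p`,
is equal to `m`. -/
def HasMultiplicity (β : Module.Basis σ ℂ V) (S : Set (ℙ ℂ V)) (p : ℙ ℂ V) (m : ℕ) : Prop :=
  HasDegree (tangentConeIdeal β S p) m

end ProjectiveVarieties

/-- The Segre variety `ℙA × ℙB × ℙC ⊆ ℙ(A ⊗ B ⊗ C)`: the classes of rank one tensors. -/
def segre (A B C : Type*) [AddCommGroup A] [Module ℂ A] [AddCommGroup B] [Module ℂ B]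
    [AddCommGroup C] [Module ℂ C] : Set (ℙ ℂ (A ⊗[ℂ] (B ⊗[ℂ] C))) :=
  {p | ∃ (a : A) (b : B) (c : C) (h : a ⊗ₜ[ℂ] (b ⊗ₜ[ℂ] c) ≠ 0), p = Projectivization.mk ℂ _ h}

end SecantMult

end

/-! The ideal of σ₄(X) turns out to be principal, generated by some F. Over a domain lowest forms
multiply, so the tangent cone ideal at z is generated by the lowest form of F at z
(`tangentConeIdeal_eq_span`), and a nonzero form of degree k > 0 cuts out a scheme of degree k
(`hasDegree_span_singleton`). The multiplicity is thus the order k of F at z.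

To bound k, take Strassen's equation, the determinant of the 9 × 9 Koszul flattening. A rank one
tensor has flattening of rank at most 2, so on a sum of four the rank is at most 8 and the
determinant vanishes (`det_koszul_sum_pureTensor`). Hence F divides it, and k is at most its order
at z. Changes of basis move z to e₀ ⊗ e₀ ⊗ e₀, where the determinant restricted to a suitable line
is t⁷(t - 1), so the order is at most 7. Whether F equals Strassen's equation is irrelevant.

For principality, the ideal is the kernel of the substitution `segreSumHom` into a domain, hence
prime. It contains no nonzero polynomial in 26 of the 27 coordinates, because the parametrization
projected to these has surjective derivative at one point (`eq_zero_of_segreSumHom_rename_eq_zero`).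
By Gauss's lemma a nonzero prime with this property is principal (`isPrincipal_of_forall_C_mem`). -/

namespace SecantMult

/-! ### Lowest-degree forms of products. -/

section LowestForms

open MvPolynomial

variable {σ R : Type*} [CommRing R]

lemma homogeneousComponents_eq_zero_iff {k : ℕ} {φ : MvPolynomial σ R} :
    (∀ j < k, homogeneousComponent j φ = 0) ↔ ∀ d : σ →₀ ℕ, d.degree < k → coeff d φ = 0 := by
  constructor
  · intro h d hd
    simpa [coeff_homogeneousComponent] using congrArg (coeff d) (h _ hd)
  · intro h j hj
    ext d
    rw [coeff_homogeneousComponent]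
    split_ifs with hd
    · simpa using h d (hd ▸ hj)
    · simp

lemma homogeneousComponent_mul_eq_zero {k n : ℕ} {φ ψ : MvPolynomial σ R}
    (h : ∀ j < k, homogeneousComponent j φ = 0) (hn : n < k) :
    homogeneousComponent n (φ * ψ) = 0 := by
  classical
  refine homogeneousComponents_eq_zero_iff.2 (fun d hd => ?_) n hn
  rw [coeff_mul]
  refine Finset.sum_eq_zero fun x hx => ?_
  rw [homogeneousComponents_eq_zero_iff.1 h x.1, zero_mul]
  rw [Finset.HasAntidiagonal.mem_antidiagonal] at hx
  rw [← hx, map_add] at hd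
  omega

/-- In total degree k + l, a pair of monomials not of degrees exactly k and l has one of degree
below its bound, where the coefficient is zero. -/
lemma homogeneousComponent_add_mul {k l : ℕ} {φ ψ : MvPolynomial σ R}
    (hφ : ∀ j < k, homogeneousComponent j φ = 0) (hψ : ∀ j < l, homogeneousComponent j ψ = 0) :
    homogeneousComponent (k + l) (φ * ψ) =
      homogeneousComponent k φ * homogeneousComponent l ψ := by
  classical
  ext d
  rw [coeff_homogeneousComponent, coeff_mul, coeff_mul]
  split_ifs with hd
  · refine Finset.sum_congr rfl fun x hx => ?_
    rw [Finset.HasAntidiagonal.mem_antidiagonal] at hx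
    rw [← hx, map_add] at hd
    rw [coeff_homogeneousComponent, coeff_homogeneousComponent]
    rcases lt_trichotomy x.1.degree k with h | h | h
    · simp [homogeneousComponents_eq_zero_iff.1 hφ _ h]
    · rw [if_pos h, if_pos (by omega)]
    · rw [homogeneousComponents_eq_zero_iff.1 hψ x.2 (by omega)]
      simp
  · refine (Finset.sum_eq_zero fun x hx => ?_).symm
    rw [Finset.HasAntidiagonal.mem_antidiagonal] at hx
    rw [← hx, map_add] at hd
    rw [coeff_homogeneousComponent, coeff_homogeneousComponent]
    by_cases h : x.1.degree = k
    · rw [if_neg (show x.2.degree ≠ l by omega), mul_zero]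
    · rw [if_neg h, zero_mul]

lemma homogeneousComponent_isHomogeneous_mul {m : ℕ} {φ : MvPolynomial σ R}
    (hφ : φ.IsHomogeneous m) (l : ℕ) (ψ : MvPolynomial σ R) :
    homogeneousComponent (m + l) (φ * ψ) = φ * homogeneousComponent l ψ := by
  have hmul : ∀ i, φ * homogeneousComponent i ψ ∈ homogeneousSubmodule σ R (m + i) := fun i =>
    hφ.mul (homogeneousComponent_isHomogeneous i ψ)
  nth_rw 1 [← sum_homogeneousComponent ψ]
  rw [Finset.mul_sum, map_sum, Finset.sum_eq_single l]
  · rw [homogeneousComponent_of_mem (hmul l), if_pos rfl]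
  · intro i _ hi
    rw [homogeneousComponent_of_mem (hmul i), if_neg (by omega)]
  · intro hl
    rw [homogeneousComponent_eq_zero l ψ (by simpa using hl), mul_zero, map_zero]

end LowestForms

/-! ### The tangent cone of a hypersurface. -/

section TangentCone

open MvPolynomial

variable {σ V : Type*} [AddCommGroup V] [Module ℂ V]

lemma translate_mul (x : σ → ℂ) (f g : MvPolynomial σ ℂ) :
    translate x (f * g) = translate x f * translate x g :=
  map_mul _ _ _

lemma tangentConeIdeal_eq_span {β : Module.Basis σ ℂ V} {S : Set (ℙ ℂ V)} {p : ℙ ℂ V}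
    {F : MvPolynomial σ ℂ} (hF : idealOf β S = Ideal.span {F}) {k : ℕ}
    (hlow : ∀ j < k, homogeneousComponent j (translate (fun i => β.repr p.rep i) F) = 0)
    (hk : homogeneousComponent k (translate (fun i => β.repr p.rep i) F) ≠ 0) :
    tangentConeIdeal β S p =
      Ideal.span {homogeneousComponent k (translate (fun i => β.repr p.rep i) F)} := by
  apply le_antisymm
  · refine Ideal.span_le.2 ?_
    rintro g ⟨f, hf, n, hn, rfl⟩
    rw [hF, Ideal.mem_span_singleton] at hf
    obtain ⟨h, rfl⟩ := hf
    rw [translate_mul] at hn ⊢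
    rw [SetLike.mem_coe]
    rcases lt_or_ge n k with hnk | hnk
    · rw [homogeneousComponent_mul_eq_zero hlow hnk]
      exact zero_mem _
    · obtain ⟨l, rfl⟩ := Nat.exists_eq_add_of_le hnk
      -- The product has order at least k + l and F has order exactly k; cancelling the lowest form
      -- of F degree by degree leaves order at least l for the cofactor.
      have hl : ∀ j < l, homogeneousComponent j (translate (fun i => β.repr p.rep i) h) = 0 := by
        intro j
        induction j using Nat.strong_induction_on with
        | _ j ih =>
          intro hj
          have := hn (k + j) (by omega)
          rw [homogeneousComponent_add_mul hlow fun i hi => ih i hi (hi.trans hj)] at this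
          exact (mul_eq_zero.1 this).resolve_left hk
      rw [homogeneousComponent_add_mul hlow hl]
      exact Ideal.mul_mem_right _ _ (Ideal.mem_span_singleton_self _)
  · refine Ideal.span_mono ?_
    rintro _ rfl
    exact ⟨F, hF ▸ Ideal.mem_span_singleton_self F, k, hlow, rfl⟩

end TangentCone

/-! ### Hilbert function and degree of a principal ideal. -/

section Hilbert

open MvPolynomial

variable {σ : Type*}

lemma finrank_homogeneousSubmodule [Fintype σ] (k : ℕ) :
    Module.finrank ℂ (homogeneousSubmodule σ ℂ k) = (Fintype.card σ + k - 1).choose k := by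
  classical
  have hfin : {d : σ →₀ ℕ | d.degree = k} = ((Finset.univ : Finset σ).finsuppAntidiag k :) := by
    ext d
    simp [Finsupp.degree_eq_sum]
  have hb := MvPolynomial.basisRestrictSupport
    (σ := σ) ℂ {d : σ →₀ ℕ | d.degree = k}
  have hE : homogeneousSubmodule σ ℂ k = restrictSupport ℂ {d : σ →₀ ℕ | d.degree = k} :=
    homogeneousSubmodule_eq_finsupp_supported σ ℂ k
  rw [hE, Module.finrank_eq_nat_card_basis hb, Nat.card_coe_set_eq, hfin, Set.ncard_coe_finset,
    Finset.card_finsuppAntidiag_nat_eq_choose, Finset.card_univ]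

instance [Finite σ] (k : ℕ) : Module.Finite ℂ (homogeneousSubmodule σ ℂ k) :=
  Module.Finite.iff_fg.2 (homogeneousSubmodule_fg σ ℂ k)

/-- Multiplication by F maps the forms of degree l isomorphically onto the degree m + l part of the
ideal. -/
lemma finrank_comap_span_singleton {F : MvPolynomial σ ℂ} {m : ℕ} (hF : F.IsHomogeneous m)
    (h0 : F ≠ 0) (l : ℕ) :
    Module.finrank ℂ (((Ideal.span {F}).restrictScalars ℂ).comap
      (homogeneousSubmodule σ ℂ (m + l)).subtype) =
      Module.finrank ℂ (homogeneousSubmodule σ ℂ l) := by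
  let μ : homogeneousSubmodule σ ℂ l →ₗ[ℂ] homogeneousSubmodule σ ℂ (m + l) :=
    ((LinearMap.mulLeft ℂ F).comp (homogeneousSubmodule σ ℂ l).subtype).codRestrict _
      fun x => hF.mul x.2
  have hμ : Function.Injective μ := by
    intro x y hxy
    have := congrArg Subtype.val hxy
    exact Subtype.ext (mul_left_cancel₀ h0 this)
  have hrange : ((Ideal.span {F}).restrictScalars ℂ).comap
      (homogeneousSubmodule σ ℂ (m + l)).subtype = LinearMap.range μ := by
    ext ⟨x, hx⟩
    simp only [Submodule.mem_comap, Submodule.subtype_apply, Submodule.restrictScalars_mem,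
      Ideal.mem_span_singleton, LinearMap.mem_range]
    constructor
    · rintro ⟨y, rfl⟩
      refine ⟨⟨homogeneousComponent l y, homogeneousComponent_mem _ _⟩, Subtype.ext ?_⟩
      change F * homogeneousComponent l y = F * y
      rw [← homogeneousComponent_isHomogeneous_mul hF l y]
      exact homogeneousComponent_eq_self hx
    · rintro ⟨y, hy⟩
      exact ⟨y, (congrArg Subtype.val hy).symm⟩
  rw [hrange, LinearMap.finrank_range_of_inj hμ]

lemma hilbertFunction_span_singleton [Fintype σ] {F : MvPolynomial σ ℂ} {m : ℕ}
    (hF : F.IsHomogeneous m) (h0 : F ≠ 0) (l : ℕ) :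
    hilbertFunction (Ideal.span {F}) (m + l) + (Fintype.card σ + l - 1).choose l =
      (Fintype.card σ + (m + l) - 1).choose (m + l) := by
  rw [← finrank_homogeneousSubmodule, ← finrank_homogeneousSubmodule,
    ← finrank_comap_span_singleton hF h0 l]
  exact Submodule.finrank_quotient_add_finrank _

/-- Pascal's rule iterated m times. It writes the difference of two dimensions of spaces of forms in
n + 2 variables as a sum of m binomials, each polynomial of degree n with leading coefficient 1/n!.
-/
lemma sum_choose_eq (n l m : ℕ) :
    ∑ i ∈ Finset.range m, (m + l - i + n).choose n + (n + 1 + l).choose (n + 1) =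
      (n + 1 + (m + l)).choose (n + 1) := by
  induction m with
  | zero => simp
  | succ m ih =>
    rw [Finset.sum_range_succ']
    have : ∀ i ∈ Finset.range m,
        (m + 1 + l - (i + 1) + n).choose n = (m + l - i + n).choose n := by
      intro i _
      congr 2
      omega
    rw [Finset.sum_congr rfl this, show n + 1 + (m + 1 + l) = (n + 1 + (m + l)) + 1 by ring,
      Nat.choose_succ_succ, ← ih, show m + 1 + l - 0 + n = n + 1 + (m + l) by omega]
    ring

lemma hasDegree_span_singleton [Fintype σ] {F : MvPolynomial σ ℂ} {m n : ℕ}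
    (hσ : Fintype.card σ = n + 2) (hF : F.IsHomogeneous m) (h0 : F ≠ 0) (hm : 0 < m) : HasDegree (Ideal.span {F}) m := by
  let P : Polynomial ℚ := ∑ i ∈ Finset.range m, Polynomial.preHilbertPoly ℚ n i
  have hcoeff : P.coeff n = m * (n.factorial : ℚ)⁻¹ := by
    simp [P, Polynomial.finsetSum_coeff, Polynomial.coeff_preHilbertPoly_self]
  have hne : P.coeff n ≠ 0 := by
    rw [hcoeff]
    positivity
  have hdeg : P.natDegree = n := by
    refine le_antisymm (Polynomial.natDegree_sum_le_of_forall_le _ _ fun i _ => ?_)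
      (Polynomial.le_natDegree_of_ne_zero hne)
    rw [Polynomial.natDegree_preHilbertPoly]
  refine ⟨P, fun h => hne (by simp [h]), ?_, ?_⟩
  · filter_upwards [Filter.eventually_ge_atTop m] with k hk
    obtain ⟨l, rfl⟩ := Nat.exists_eq_add_of_le hk
    have h1 := hilbertFunction_span_singleton hF h0 l
    have h2 := sum_choose_eq n l m
    rw [hσ, show n + 2 + l - 1 = n + 1 + l by omega,
      show n + 2 + (m + l) - 1 = n + 1 + (m + l) by omega,
      ← Nat.choose_symm_add, ← Nat.choose_symm_add, ← h2, Nat.add_right_cancel_iff] at h1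
    rw [h1, Polynomial.eval_finsetSum]
    push_cast
    refine Finset.sum_congr rfl fun i hi => ?_
    rw [Finset.mem_range] at hi
    have := Polynomial.preHilbertPoly_eq_choose_sub_add ℚ n (show i ≤ m + l by omega)
    push_cast at this
    rw [this]
  · rw [Polynomial.leadingCoeff, hdeg, hcoeff]
    field_simp

end Hilbert

/-! ### Principality of prime ideals with trivial elimination ideal. -/

section Principal

/-- A prime element F of I is nonconstant, hence primitive, hence irreducible over the fraction
field by Gauss. If F failed to divide some g in I, the two would be coprime there, and a Bézout
identity with denominators cleared would put a nonzero constant into I. -/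
lemma isPrincipal_of_forall_C_mem {R : Type*} [CommRing R] [IsDomain R]
    [UniqueFactorizationMonoid R] {I : Ideal (Polynomial R)} (hI : I.IsPrime) (h0 : I ≠ ⊥)
    (hC : ∀ r, Polynomial.C r ∈ I → r = 0) : ∃ F, I = Ideal.span {F} := by
  classical
  obtain ⟨F, hFI, hF⟩ := hI.exists_mem_prime_of_ne_bot h0
  refine ⟨F, le_antisymm (fun g hg => ?_) ((Ideal.span_singleton_le_iff_mem _).2 hFI)⟩
  rw [Ideal.mem_span_singleton]
  let K := FractionRing R
  have hdeg : F.natDegree ≠ 0 := by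
    intro h
    rw [Polynomial.eq_C_of_natDegree_eq_zero h] at hFI hF
    rw [hC _ hFI, Polynomial.C_0] at hF
    exact hF.ne_zero rfl
  have hprim : F.IsPrimitive := hF.irreducible.isPrimitive hdeg
  by_contra hnd
  let := Classical.arbitrary (NormalizedGCDMonoid R)
  have hirr : Irreducible (F.map (algebraMap R K)) :=
    hprim.irreducible_iff_irreducible_map_fraction_map.1 hF.irreducible
  have hcop : IsCoprime (F.map (algebraMap R K)) (g.map (algebraMap R K)) := by
    refine (hirr.coprime_iff_not_dvd).2 fun h => hnd ?_
    obtain ⟨q, hq⟩ := h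
    -- Primitivity of F makes a quotient over the fraction field descend to R.
    have hl : F.map (algebraMap R K) * q ∈ Polynomial.lifts (algebraMap R K) := by
      rw [← hq]
      exact ⟨g, rfl⟩
    obtain ⟨q', rfl⟩ := (hprim.map_mul_mem_lifts_iff).1 hl
    refine ⟨q', Polynomial.map_injective _ (IsFractionRing.injective R K) ?_⟩
    rw [hq, Polynomial.map_mul]
    rfl
  obtain ⟨u, v, huv⟩ := hcop
  obtain ⟨c, hc0, hc⟩ := IsLocalization.integerNormalization_spec (nonZeroDivisors R) u
  obtain ⟨d, hd0, hd⟩ := IsLocalization.integerNormalization_spec (nonZeroDivisors R) v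
  refine nonZeroDivisors.ne_zero (mul_mem hc0 hd0) (hC _ ?_)
  have key : Polynomial.C (c * d) =
      Polynomial.C d * IsLocalization.integerNormalization (nonZeroDivisors R) u * F +
      Polynomial.C c * IsLocalization.integerNormalization (nonZeroDivisors R) v * g := by
    apply Polynomial.map_injective _ (IsFractionRing.injective R K)
    rw [Algebra.smul_def, Polynomial.algebraMap_apply] at hc hd
    simp only [Polynomial.map_mul, Polynomial.map_add, Polynomial.map_C, hc, hd, map_mul]
    linear_combination (- Polynomial.C (algebraMap R K c) * Polynomial.C (algebraMap R K d)) * huv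
  rw [key]
  exact add_mem (I.mul_mem_left _ hFI) (I.mul_mem_left _ hg)

lemma exists_eq_span_singleton_of_forall_rename_mem {σ k : Type*} [Field k] (s : σ)
    {I : Ideal (MvPolynomial σ k)} (hI : I.IsPrime) (h0 : I ≠ ⊥)
    (hs : ∀ r : MvPolynomial {t // t ≠ s} k, MvPolynomial.rename Subtype.val r ∈ I → r = 0) :
    ∃ F, I = Ideal.span {F} := by
  classical
  let e : MvPolynomial σ k ≃ₐ[k] Polynomial (MvPolynomial {t // t ≠ s} k) :=
    (MvPolynomial.renameEquiv k (Equiv.optionSubtypeNe s).symm).trans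
      (MvPolynomial.optionEquivLeft k _)
  have hmem : ∀ f, f ∈ I.comap (e.symm : _ →+* MvPolynomial σ k) ↔ e.symm f ∈ I :=
    fun f => Iff.rfl
  have heC : ∀ r, e (MvPolynomial.rename Subtype.val r) = Polynomial.C r := by
    intro r
    induction r using MvPolynomial.induction_on with
    | C a => simp [e]
    | add p q hp hq => simp only [map_add, hp, hq]
    | mul_X p i hp =>
      rw [map_mul, map_mul, hp, map_mul, MvPolynomial.rename_X]
      simp [e, i.2]
  obtain ⟨F, hF⟩ := isPrincipal_of_forall_C_mem (R := MvPolynomial {t // t ≠ s} k)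
    (I := I.comap (e.symm : _ →+* MvPolynomial σ k)) (Ideal.comap_isPrime _ _) (by
      intro h
      refine h0 ((Submodule.eq_bot_iff _).2 fun x hx => ?_)
      have : e x ∈ I.comap (e.symm : _ →+* MvPolynomial σ k) := by
        rw [hmem]; simpa using hx
      rw [h] at this
      simpa using this) (by
      intro r hr
      rw [hmem, ← heC, AlgEquiv.symm_apply_apply] at hr
      exact hs r hr)
  refine ⟨e.symm F, Ideal.ext fun x => ?_⟩
  have : x ∈ I ↔ e x ∈ I.comap (e.symm : _ →+* MvPolynomial σ k) := by
    rw [hmem]; simp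
  rw [this, hF, Ideal.mem_span_singleton, Ideal.mem_span_singleton]
  constructor
  · rintro ⟨q, hq⟩
    exact ⟨e.symm q, by rw [← map_mul, ← hq, AlgEquiv.symm_apply_apply]⟩
  · rintro ⟨q, rfl⟩
    exact ⟨e q, by simp⟩

end Principal

/-! ### The Koszul flattening and Strassen's equation. -/

section Strassen

open Matrix
open scoped Kronecker

variable {R : Type*} [CommRing R]

/-- The matrix of the cross product with `v`. -/
def crossMatrix (v : Fin 3 → R) : Matrix (Fin 3) (Fin 3) R :=
  !![0, -v 2, v 1; v 2, 0, -v 0; -v 1, v 0, 0]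

/-- The Koszul flattening of a `3 × 3 × 3` tensor `x`. -/
def koszul (x : Fin 3 × (Fin 3 × Fin 3) → R) : Matrix (Fin 3 × Fin 3) (Fin 3 × Fin 3) R :=
  Matrix.of fun p q => crossMatrix (fun l => x (l, p.2, q.2)) p.1 q.1

/-- The coordinates of the rank one tensor `u ⊗ v ⊗ w`. -/
def pureTensor (u v w : Fin 3 → R) : Fin 3 × (Fin 3 × Fin 3) → R :=
  fun s => u s.1 * v s.2.1 * w s.2.2

/-- Change of basis in the first factor. -/
def actFst (g : Matrix (Fin 3) (Fin 3) R) (x : Fin 3 × (Fin 3 × Fin 3) → R) :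
    Fin 3 × (Fin 3 × Fin 3) → R :=
  fun s => ∑ l, g s.1 l * x (l, s.2)

/-- Change of bases in the second and third factors. -/
def actSnd (h k : Matrix (Fin 3) (Fin 3) R) (x : Fin 3 × (Fin 3 × Fin 3) → R) :
    Fin 3 × (Fin 3 × Fin 3) → R :=
  fun s => ∑ m, ∑ n, h s.2.1 m * k s.2.2 n * x (s.1, m, n)

lemma crossMatrix_add (v w : Fin 3 → R) :
    crossMatrix (v + w) = crossMatrix v + crossMatrix w := by
  ext i j
  fin_cases i <;> fin_cases j <;> simp [crossMatrix, add_comm]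

lemma det_crossMatrix (v : Fin 3 → R) : (crossMatrix v).det = 0 := by
  simp [crossMatrix, Matrix.det_fin_three]
  ring

/-- The bilinear form of `crossMatrix v` is (a, b) ↦ det(a, v, b), and det(ga, gv, gb) = det g ·
det(a, v, b). -/
lemma transpose_mul_crossMatrix_mul (g : Matrix (Fin 3) (Fin 3) R) (v : Fin 3 → R) :
    gᵀ * crossMatrix (g *ᵥ v) * g = g.det • crossMatrix v := by
  ext i j
  fin_cases i <;> fin_cases j <;>
    simp [crossMatrix, Matrix.mul_apply, Matrix.mulVec, dotProduct, Fin.sum_univ_three,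
      Matrix.det_fin_three] <;> ring

lemma koszul_add (x y : Fin 3 × (Fin 3 × Fin 3) → R) : koszul (x + y) = koszul x + koszul y := by
  ext p q
  exact congrFun (congrFun (crossMatrix_add (fun l => x (l, p.2, q.2))
    (fun l => y (l, p.2, q.2))) p.1) q.1

lemma koszul_actFst (g : Matrix (Fin 3) (Fin 3) R) (x : Fin 3 × (Fin 3 × Fin 3) → R) :
    (gᵀ ⊗ₖ (1 : Matrix (Fin 3) (Fin 3) R)) * koszul (actFst g x) *
      (g ⊗ₖ (1 : Matrix (Fin 3) (Fin 3) R)) = g.det • koszul x := by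
  ext p q
  have := congrFun (congrFun (transpose_mul_crossMatrix_mul g
    (fun l => x (l, p.2, q.2))) p.1) q.1
  simp only [Matrix.mul_apply, Matrix.smul_apply] at this
  simp only [Matrix.mul_apply, Fintype.sum_prod_type, kroneckerMap_apply, Matrix.one_apply,
    mul_ite, ite_mul, mul_one, mul_zero, zero_mul, Finset.sum_ite_eq, Finset.sum_ite_eq',
    Finset.mem_univ, if_true, Matrix.smul_apply]
  exact this

lemma koszul_actSnd (h k : Matrix (Fin 3) (Fin 3) R) (x : Fin 3 × (Fin 3 × Fin 3) → R) :
    koszul (actSnd h k x) =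
      ((1 : Matrix (Fin 3) (Fin 3) R) ⊗ₖ h) * koszul x * ((1 : Matrix (Fin 3) (Fin 3) R) ⊗ₖ kᵀ) := by
  ext ⟨p, m⟩ ⟨q, n⟩
  simp only [Matrix.mul_apply, Fintype.sum_prod_type, kroneckerMap_apply, Matrix.one_apply,
    mul_ite, ite_mul, one_mul, mul_zero, zero_mul, Finset.sum_ite_irrel,
    Finset.sum_const_zero, Finset.sum_ite_eq, Finset.sum_ite_eq', Finset.mem_univ, if_true]
  fin_cases p <;> fin_cases q <;>
    simp [koszul, crossMatrix, actSnd, Fin.sum_univ_three] <;> ring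

lemma det_koszul_actFst {K : Type*} [Field K] {g : Matrix (Fin 3) (Fin 3) K} (hg : g.det ≠ 0)
    (x : Fin 3 × (Fin 3 × Fin 3) → K) :
    (koszul (actFst g x)).det = g.det ^ 3 * (koszul x).det := by
  have h := congrArg Matrix.det (koszul_actFst g x)
  simp only [Matrix.det_mul, Matrix.det_smul, Matrix.det_kronecker, Matrix.det_transpose,
    Matrix.det_one, one_pow, mul_one, Fintype.card_prod, Fintype.card_fin] at h
  -- Each Kronecker factor contributes the cube of `g.det`, against the ninth power from the scalar
  -- on the right.
  apply mul_left_cancel₀ (pow_ne_zero 6 hg)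
  linear_combination h

lemma det_koszul_actSnd (h k : Matrix (Fin 3) (Fin 3) R) (x : Fin 3 × (Fin 3 × Fin 3) → R) :
    (koszul (actSnd h k x)).det = h.det ^ 3 * k.det ^ 3 * (koszul x).det := by
  rw [koszul_actSnd]
  simp only [Matrix.det_mul, Matrix.det_kronecker, Matrix.det_transpose,
    Matrix.det_one, one_pow, one_mul, Fintype.card_fin]
  ring

lemma rank_add_le {K m n : Type*} [Field K] [Fintype m] [Fintype n] (M N : Matrix m n K) :
    (M + N).rank ≤ M.rank + N.rank := by
  unfold Matrix.rank
  rw [Matrix.mulVecLin_add]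
  exact (Submodule.finrank_mono (LinearMap.range_add_le _ _)).trans
    (Submodule.finrank_add_le_finrank_add_finrank _ _)

/-- The flattening is the Kronecker product of `crossMatrix u` with the rank one matrix v wᵀ, so it
factors through `crossMatrix u`, which is singular of size 3. -/
lemma rank_koszul_pureTensor {K : Type*} [Field K] (u v w : Fin 3 → K) :
    (koszul (pureTensor u v w)).rank ≤ 2 := by
  have hfac : koszul (pureTensor u v w) =
      (Matrix.of fun (p : Fin 3 × Fin 3) i => if p.1 = i then v p.2 else 0) * crossMatrix u *
        (Matrix.of fun i (q : Fin 3 × Fin 3) => if i = q.1 then w q.2 else 0) := by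
    ext ⟨p, m⟩ ⟨q, n⟩
    simp only [Matrix.mul_apply, Matrix.of_apply, ite_mul, zero_mul, mul_ite, mul_zero,
      Finset.sum_ite_eq, Finset.sum_ite_eq', Finset.mem_univ, if_true]
    fin_cases p <;> fin_cases q <;> simp [koszul, crossMatrix, pureTensor, -mul_eq_mul_right_iff] <;> ring
  have hcross : (crossMatrix u).rank ≤ 2 := by
    have h1 : (crossMatrix u).rank ≤ 3 := by
      simpa using (crossMatrix u).rank_le_card_width
    have h2 : (crossMatrix u).rank ≠ 3 := by
      intro h
      have hr : LinearMap.range (crossMatrix u).mulVecLin = ⊤ := by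
        apply Submodule.eq_top_of_finrank_eq
        rw [Module.finrank_fin_fun]
        exact h
      have hs : Function.Surjective (crossMatrix u).mulVec := LinearMap.range_eq_top.1 hr
      have := (Matrix.isUnit_iff_isUnit_det _).1 (Matrix.mulVec_surjective_iff_isUnit.1 hs)
      rw [det_crossMatrix] at this
      exact not_isUnit_zero this
    omega
  rw [hfac]
  exact (Matrix.rank_mul_le_left _ _).trans ((Matrix.rank_mul_le_right _ _).trans hcross)

lemma det_koszul_sum_pureTensor {K : Type*} [Field K] (u v w : Fin 4 → Fin 3 → K) :
    (koszul (∑ i, pureTensor (u i) (v i) (w i))).det = 0 := by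
  by_contra h
  have h9 := Matrix.rank_of_det_ne_zero h
  simp only [Fin.sum_univ_four, koszul_add, Fintype.card_prod, Fintype.card_fin] at h9
  have h1 := rank_koszul_pureTensor (u 0) (v 0) (w 0)
  have h2 := rank_koszul_pureTensor (u 1) (v 1) (w 1)
  have h3 := rank_koszul_pureTensor (u 2) (v 2) (w 2)
  have h4 := rank_koszul_pureTensor (u 3) (v 3) (w 3)
  have h5 := rank_add_le (koszul (pureTensor (u 0) (v 0) (w 0)))
    (koszul (pureTensor (u 1) (v 1) (w 1)))
  have h6 := rank_add_le (koszul (pureTensor (u 0) (v 0) (w 0)) +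
    koszul (pureTensor (u 1) (v 1) (w 1))) (koszul (pureTensor (u 2) (v 2) (w 2)))
  have h7 := rank_add_le (koszul (pureTensor (u 0) (v 0) (w 0)) +
    koszul (pureTensor (u 1) (v 1) (w 1)) + koszul (pureTensor (u 2) (v 2) (w 2)))
    (koszul (pureTensor (u 3) (v 3) (w 3)))
  omega

/-- A direction in which Strassen's equation has order seven at `e₀ ⊗ e₀ ⊗ e₀`. -/
def testDirection : Fin 3 × (Fin 3 × Fin 3) → R := fun s =>
  (![!![0, 0, 0; 0, 1, 0; 0, 0, 1], !![0, 1, 0; 0, 0, 1; 0, 0, 0],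
    !![0, 0, 0; 1, 0, 0; 0, 1, 0]] : Fin 3 → Matrix (Fin 3) (Fin 3) R) s.1 s.2.1 s.2.2

lemma det_eq_of_row {n : ℕ} (M : Matrix (Fin (n + 1)) (Fin (n + 1)) R) (i j : Fin (n + 1))
    (h : ∀ k, k ≠ j → M i k = 0) :
    M.det = (-1) ^ (i + j : ℕ) * M i j * (M.submatrix i.succAbove j.succAbove).det := by
  rw [Matrix.det_succ_row M i, Finset.sum_eq_single j]
  · intro k _ hk
    rw [h k hk]
    ring
  · simp

/-- The matrix of `koszul` at `e₀ ⊗ e₀ ⊗ e₀ + t • testDirection`. -/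
def testMatrix (t : R) : Matrix (Fin 9) (Fin 9) R :=
  !![0, 0, 0, 0, 0, 0, 0, t, 0;
        0, 0, 0, -t, 0, 0, 0, 0, t;
        0, 0, 0, 0, -t, 0, 0, 0, 0;
        0, 0, 0, 0, 0, 0, -1, 0, 0;
        t, 0, 0, 0, 0, 0, 0, -t, 0;
        0, t, 0, 0, 0, 0, 0, 0, -t;
        0, -t, 0, 1, 0, 0, 0, 0, 0;
        0, 0, -t, 0, t, 0, 0, 0, 0;
        0, 0, 0, 0, 0, t, 0, 0, 0]

set_option maxHeartbeats 1000000 in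
lemma koszul_add_smul_testDirection (t : R) :
    (koszul (pureTensor (Pi.single 0 1) (Pi.single 0 1) (Pi.single 0 1) +
      t • testDirection)).submatrix finProdFinEquiv.symm finProdFinEquiv.symm = testMatrix t := by
  unfold testMatrix
  ext i j
  fin_cases i <;> fin_cases j <;>
    simp [koszul, crossMatrix, pureTensor, testDirection, finProdFinEquiv, Fin.divNat, Fin.modNat]

-- At t = 0 only two entries survive, so a factor t⁷ is forced; the point is that the cofactor t - 1
-- is nonzero at 0. Six expansions along rows with a single nonzero entry leave a 3 × 3 determinant.
set_option maxHeartbeats 1000000 in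
lemma det_testMatrix (t : R) : (testMatrix t).det = t ^ 7 * (t - 1) := by
  unfold testMatrix
  rw [det_eq_of_row _ 0 7 (by intro k hk; fin_cases k <;> first | rfl | exact absurd rfl hk),
    show Matrix.submatrix _ (Fin.succAbove 0) (Fin.succAbove 7) =
      (!![0, 0, 0, -t, 0, 0, 0, t; 0, 0, 0, 0, -t, 0, 0, 0; 0, 0, 0, 0, 0, 0, -1, 0;
        t, 0, 0, 0, 0, 0, 0, 0; 0, t, 0, 0, 0, 0, 0, -t; 0, -t, 0, 1, 0, 0, 0, 0;
        0, 0, -t, 0, t, 0, 0, 0; 0, 0, 0, 0, 0, t, 0, 0] : Matrix (Fin 8) (Fin 8) R) by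
      ext i j; fin_cases i <;> fin_cases j <;> rfl]
  rw [det_eq_of_row _ 1 4 (by intro k hk; fin_cases k <;> first | rfl | exact absurd rfl hk),
    show Matrix.submatrix _ (Fin.succAbove 1) (Fin.succAbove 4) =
      (!![0, 0, 0, -t, 0, 0, t; 0, 0, 0, 0, 0, -1, 0; t, 0, 0, 0, 0, 0, 0; 0, t, 0, 0, 0, 0, -t;
        0, -t, 0, 1, 0, 0, 0; 0, 0, -t, 0, 0, 0, 0;
        0, 0, 0, 0, t, 0, 0] : Matrix (Fin 7) (Fin 7) R) by
      ext i j; fin_cases i <;> fin_cases j <;> rfl]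
  rw [det_eq_of_row _ 1 5 (by intro k hk; fin_cases k <;> first | rfl | exact absurd rfl hk),
    show Matrix.submatrix _ (Fin.succAbove 1) (Fin.succAbove 5) =
      (!![0, 0, 0, -t, 0, t; t, 0, 0, 0, 0, 0; 0, t, 0, 0, 0, -t; 0, -t, 0, 1, 0, 0;
        0, 0, -t, 0, 0, 0; 0, 0, 0, 0, t, 0] : Matrix (Fin 6) (Fin 6) R) by
      ext i j; fin_cases i <;> fin_cases j <;> rfl]
  rw [det_eq_of_row _ 1 0 (by intro k hk; fin_cases k <;> first | rfl | exact absurd rfl hk),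
    show Matrix.submatrix _ (Fin.succAbove 1) (Fin.succAbove 0) =
      (!![0, 0, -t, 0, t; t, 0, 0, 0, -t; -t, 0, 1, 0, 0; 0, -t, 0, 0, 0;
        0, 0, 0, t, 0] : Matrix (Fin 5) (Fin 5) R) by
      ext i j; fin_cases i <;> fin_cases j <;> rfl]
  rw [det_eq_of_row _ 3 1 (by intro k hk; fin_cases k <;> first | rfl | exact absurd rfl hk),
    show Matrix.submatrix _ (Fin.succAbove 3) (Fin.succAbove 1) =
      (!![0, -t, 0, t; t, 0, 0, -t; -t, 1, 0, 0; 0, 0, t, 0] : Matrix (Fin 4) (Fin 4) R) by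
      ext i j; fin_cases i <;> fin_cases j <;> rfl]
  rw [det_eq_of_row _ 3 2 (by intro k hk; fin_cases k <;> first | rfl | exact absurd rfl hk),
    show Matrix.submatrix _ (Fin.succAbove 3) (Fin.succAbove 2) =
      (!![0, -t, t; t, 0, -t; -t, 1, 0] : Matrix (Fin 3) (Fin 3) R) by
      ext i j; fin_cases i <;> fin_cases j <;> rfl]
  rw [Matrix.det_fin_three]
  simp
  ring

lemma det_koszul_add_smul_testDirection (t : R) :
    (koszul (pureTensor (Pi.single 0 1) (Pi.single 0 1) (Pi.single 0 1) +
      t • testDirection)).det = t ^ 7 * (t - 1) := by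
  rw [← Matrix.det_submatrix_equiv_self finProdFinEquiv.symm, koszul_add_smul_testDirection,
    det_testMatrix]

end Strassen

/-! ### Pulling polynomials back along sums of four rank one tensors. -/

section Parametrization

open MvPolynomial

/-- The coordinates of a sum of four rank one tensors, in terms of the coordinates of the twelve
vectors involved. -/
def segreSum {R : Type*} [CommRing R] (θ : Fin 3 × Fin 4 × Fin 3 → R) :
    Fin 3 × (Fin 3 × Fin 3) → R :=
  ∑ i, pureTensor (fun l => θ (0, i, l)) (fun l => θ (1, i, l)) (fun l => θ (2, i, l))

lemma segreSum_apply {R : Type*} [CommRing R] (θ : Fin 3 × Fin 4 × Fin 3 → R)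
    (s : Fin 3 × (Fin 3 × Fin 3)) :
    segreSum θ s = ∑ i, θ (0, i, s.1) * θ (1, i, s.2.1) * θ (2, i, s.2.2) := by
  simp [segreSum, pureTensor]

/-- Substitution of the parametrization of the sums of four rank one tensors. -/
noncomputable def segreSumHom : MvPolynomial (Fin 3 × (Fin 3 × Fin 3)) ℂ →ₐ[ℂ]
    MvPolynomial (Fin 3 × Fin 4 × Fin 3) ℂ :=
  aeval (segreSum X)

lemma eval_segreSumHom (θ : Fin 3 × Fin 4 × Fin 3 → ℂ)
    (g : MvPolynomial (Fin 3 × (Fin 3 × Fin 3)) ℂ) :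
    eval θ (segreSumHom g) = eval (segreSum θ) g := by
  induction g using MvPolynomial.induction_on with
  | C a => simp [segreSumHom]
  | add p q hp hq => simp only [map_add, hp, hq]
  | mul_X p s hp =>
    rw [map_mul, map_mul, hp, map_mul]
    simp [segreSumHom, segreSum_apply]

lemma segreSumHom_eq_zero_iff {g : MvPolynomial (Fin 3 × (Fin 3 × Fin 3)) ℂ} :
    segreSumHom g = 0 ↔ ∀ θ, eval (segreSum θ) g = 0 := by
  constructor
  · intro h θ
    rw [← eval_segreSumHom, h, map_zero]
  · intro h
    exact MvPolynomial.funext fun θ => by rw [eval_segreSumHom, h, map_zero]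

/-- The cone over a projective set omits the origin. Multiplying g by a coordinate covers the
parameters with zero sum, and the pullback of that coordinate is nonzero in a domain. -/
lemma segreSumHom_eq_zero_of_forall_ne_zero {g : MvPolynomial (Fin 3 × (Fin 3 × Fin 3)) ℂ}
    (h : ∀ θ, segreSum θ ≠ 0 → eval (segreSum θ) g = 0) : segreSumHom g = 0 := by
  have hX : segreSumHom (X (0, 0, 0)) ≠ 0 := by
    intro h0
    have := segreSumHom_eq_zero_iff.1 h0 fun _ => 1
    simp [segreSum_apply] at this
  refine (mul_eq_zero.1 ?_).resolve_right hX
  rw [← map_mul, segreSumHom_eq_zero_iff]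
  intro θ
  rw [map_mul]
  by_cases hθ : segreSum θ = 0
  · simp [hθ]
  · rw [h θ hθ, zero_mul]

end Parametrization

/-! ### The ideal of the secant variety as the kernel of the substitution. -/

section Secant

open MvPolynomial

lemma idealOf_zariskiClosure {σ V : Type*} [AddCommGroup V] [Module ℂ V]
    (β : Module.Basis σ ℂ V) (Y : Set (ℙ ℂ V)) :
    idealOf β (zariskiClosure β Y) = idealOf β Y := by
  apply le_antisymm
  · refine vanishingIdeal_anti_mono ?_
    rintro x ⟨v, hv, hY, rfl⟩
    refine ⟨v, hv, ?_, rfl⟩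
    rintro y ⟨w, hw, hwv, rfl⟩
    intro f hf
    refine hf _ ⟨w, hw, ?_, rfl⟩
    rw [Set.mem_singleton_iff] at hwv
    rwa [hwv]
  · rintro f hf x ⟨v, hv, hY, rfl⟩
    exact hY ⟨v, hv, rfl, rfl⟩ f hf

variable {A B C : Type*} [AddCommGroup A] [Module ℂ A] [AddCommGroup B] [Module ℂ B]
    [AddCommGroup C] [Module ℂ C]
    (a : Module.Basis (Fin 3) ℂ A) (b : Module.Basis (Fin 3) ℂ B) (c : Module.Basis (Fin 3) ℂ C)

lemma repr_tmul (u : A) (v : B) (w : C) :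
    (fun s => (a.tensorProduct (b.tensorProduct c)).repr (u ⊗ₜ[ℂ] (v ⊗ₜ[ℂ] w)) s) =
      pureTensor (a.repr u) (b.repr v) (c.repr w) := by
  ext ⟨i, j, k⟩
  simp [pureTensor]
  ring

lemma exists_segreSum_of_mem_coneCoords {x : Fin 3 × (Fin 3 × Fin 3) → ℂ}
    (hx : x ∈ coneCoords (a.tensorProduct (b.tensorProduct c)) (rankLE (segre A B C) 4)) :
    ∃ θ, x = segreSum θ := by
  obtain ⟨v, hv, ⟨z, hz, hle⟩, rfl⟩ := hx
  choose p q r hne hz using hz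
  have hmem : v ∈ ⨆ i, (z i).submodule := hle (Submodule.mem_span_singleton_self v)
  have hsub : ∀ i, (z i).submodule = Submodule.span ℂ {p i ⊗ₜ[ℂ] (q i ⊗ₜ[ℂ] r i)} := fun i => by
    rw [hz i, Projectivization.submodule_mk]
  simp only [hsub] at hmem
  rw [← Submodule.span_range_eq_iSup, Submodule.mem_span_range_iff_exists_fun] at hmem
  obtain ⟨t, rfl⟩ := hmem
  -- The coefficients of the linear combination are absorbed into the first tensor factors.
  refine ⟨fun s => (![fun i l => t i * a.repr (p i) l, fun i l => b.repr (q i) l,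
    fun i l => c.repr (r i) l] : Fin 3 → Fin 4 → Fin 3 → ℂ) s.1 s.2.1 s.2.2, ?_⟩
  ext s
  have h := fun i => congrFun (repr_tmul a b c (p i) (q i) (r i)) s
  simp only [map_sum, map_smul, Finsupp.coe_finsetSum, Finset.sum_apply, Finsupp.smul_apply, h,
    segreSum_apply]
  simp [pureTensor, mul_assoc]

lemma segreSum_mem_coneCoords {θ : Fin 3 × Fin 4 × Fin 3 → ℂ} (hθ : segreSum θ ≠ 0) :
    segreSum θ ∈ coneCoords (a.tensorProduct (b.tensorProduct c)) (rankLE (segre A B C) 4) := by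
  classical
  let w : Fin 4 → A ⊗[ℂ] (B ⊗[ℂ] C) := fun i => a.equivFun.symm (fun l => θ (0, i, l)) ⊗ₜ[ℂ]
    (b.equivFun.symm (fun l => θ (1, i, l)) ⊗ₜ[ℂ] c.equivFun.symm (fun l => θ (2, i, l)))
  have hrepr : (fun s => (a.tensorProduct (b.tensorProduct c)).repr (∑ i, w i) s) =
      segreSum θ := by
    ext s
    have h := fun i => congrFun (repr_tmul a b c (a.equivFun.symm (fun l => θ (0, i, l)))
      (b.equivFun.symm (fun l => θ (1, i, l))) (c.equivFun.symm (fun l => θ (2, i, l)))) s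
    simp only [w, map_sum, Finsupp.coe_finsetSum, Finset.sum_apply, h, segreSum]
    simp only [← Module.Basis.equivFun_apply, LinearEquiv.apply_symm_apply]
  have hne : ∑ i, w i ≠ 0 := by
    intro h
    apply hθ
    rw [← hrepr, h]
    ext s
    simp
  obtain ⟨i₀, hi₀⟩ : ∃ i, w i ≠ 0 := by
    by_contra! h
    exact hne (Finset.sum_eq_zero fun i _ => h i)
  -- A zero summand defines no projective point; any point of the Segre variety can fill its slot,
  -- and the class of a nonzero summand is at hand.
  refine ⟨_, hne, ⟨fun i => if h : w i ≠ 0 then Projectivization.mk ℂ (w i) h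
    else Projectivization.mk ℂ (w i₀) hi₀, fun i => ?_, ?_⟩, hrepr.symm⟩
  · dsimp only
    split_ifs with h
    · exact ⟨_, _, _, h, rfl⟩
    · exact ⟨_, _, _, hi₀, rfl⟩
  · rw [Projectivization.submodule_mk, Submodule.span_singleton_le_iff_mem]
    refine Submodule.sum_mem _ fun i _ => ?_
    by_cases h : w i = 0
    · rw [h]
      exact zero_mem _
    · refine Submodule.mem_iSup_of_mem i ?_
      dsimp only
      rw [dif_pos h, Projectivization.submodule_mk]
      exact Submodule.mem_span_singleton_self _

lemma mem_idealOf_secantVariety_iff {g : MvPolynomial (Fin 3 × (Fin 3 × Fin 3)) ℂ} :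
    g ∈ idealOf (a.tensorProduct (b.tensorProduct c))
      (secantVariety (a.tensorProduct (b.tensorProduct c)) (segre A B C) 4) ↔
      segreSumHom g = 0 := by
  rw [secantVariety, idealOf_zariskiClosure]
  constructor
  · intro h
    refine segreSumHom_eq_zero_of_forall_ne_zero fun θ hθ => ?_
    have := h _ (segreSum_mem_coneCoords a b c hθ)
    rwa [aeval_eq_eval] at this
  · intro h x hx
    obtain ⟨θ, rfl⟩ := exists_segreSum_of_mem_coneCoords a b c hx
    rw [aeval_eq_eval]
    exact segreSumHom_eq_zero_iff.1 h θ

lemma idealOf_secantVariety_isPrime :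
    (idealOf (a.tensorProduct (b.tensorProduct c))
      (secantVariety (a.tensorProduct (b.tensorProduct c)) (segre A B C) 4)).IsPrime := by
  have : idealOf (a.tensorProduct (b.tensorProduct c))
      (secantVariety (a.tensorProduct (b.tensorProduct c)) (segre A B C) 4) =
      RingHom.ker segreSumHom := by
    ext g
    rw [mem_idealOf_secantVariety_iff, RingHom.mem_ker]
  rw [this]
  exact RingHom.ker_isPrime _

end Secant

/-! ### Dominance of the parametrization onto 26 coordinates. -/

section Dominance

open MvPolynomial Filter Topology

/-- A neighbourhood contains a product of infinite sets, and vanishing on such a product forces a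
polynomial to be zero. -/
lemma eq_zero_of_eventually_eval_eq_zero {τ : Type*} [Fintype τ] {g : MvPolynomial τ ℂ}
    {x : τ → ℂ} (h : ∀ᶠ y in 𝓝 x, eval y g = 0) : g = 0 := by
  obtain ⟨ε, hε, hball⟩ := Metric.eventually_nhds_iff_ball.1 h
  refine MvPolynomial.funext_set (fun i => Metric.ball (x i) ε)
    (fun i => infinite_of_mem_nhds (x i) (Metric.ball_mem_nhds _ hε)) fun y hy => ?_
  rw [map_zero]
  refine hball y ?_
  rwa [ball_pi _ hε]

/-- The base point of the parametrization: the three diagonal tensors and the all-one tensor. -/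
noncomputable def basePoint : Fin 3 × Fin 4 × Fin 3 → ℂ := fun s =>
  if s.2.1 = 3 then 1 else if s.2.1 = s.2.2.castSucc then 1 else 0

/-- The differential of `segreSum` at `basePoint`. -/
noncomputable def segreSumDeriv : (Fin 3 × Fin 4 × Fin 3 → ℂ) →L[ℂ] (Fin 3 × (Fin 3 × Fin 3) → ℂ) :=
  ContinuousLinearMap.pi fun s => ∑ i : Fin 4,
    ((basePoint (0, i, s.1) * basePoint (1, i, s.2.1)) • ContinuousLinearMap.proj (2, i, s.2.2) +
      basePoint (2, i, s.2.2) • (basePoint (0, i, s.1) • ContinuousLinearMap.proj (1, i, s.2.1) +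
        basePoint (1, i, s.2.1) • ContinuousLinearMap.proj (0, i, s.1)))

lemma hasStrictFDerivAt_segreSum :
    HasStrictFDerivAt (segreSum : (Fin 3 × Fin 4 × Fin 3 → ℂ) → _) segreSumDeriv basePoint := by
  rw [hasStrictFDerivAt_pi']
  intro s
  simp only [segreSum_apply]
  have hp : ∀ i, HasStrictFDerivAt (𝕜 := ℂ) (fun θ : Fin 3 × Fin 4 × Fin 3 → ℂ => θ i)
    (ContinuousLinearMap.proj i) basePoint := fun i => hasStrictFDerivAt_apply i basePoint
  exact HasStrictFDerivAt.fun_sum fun i _ => ((hp _).mul (hp _)).mul (hp _)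

/-- A section of `segreSumDeriv` away from the coordinate `(0, 1, 2)`. -/
noncomputable def derivSection (y : Fin 3 × (Fin 3 × Fin 3) → ℂ) : Fin 3 × Fin 4 × Fin 3 → ℂ :=
  -- Variations of the fourth, all-one tensor. At pairwise distinct (l, m, n) they alone contribute,
  -- by α l + β m + γ n; these values solve the five such equations other than the one at (0, 1, 2).
  let α : Fin 3 → ℂ := ![0, y (1, 2, 0), y (2, 0, 1) - y (0, 2, 1)]
  let β : Fin 3 → ℂ := ![0, y (2, 1, 0) - y (2, 0, 1) + y (0, 2, 1), 0]
  let γ : Fin 3 → ℂ := ![0, y (0, 2, 1), y (1, 0, 2) - y (1, 2, 0)]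
  -- The remainder at indices with a repetition is supplied by the three diagonal tensors; the zeros
  -- below keep (i, i, i) from being counted three times.
  let r : Fin 3 → Fin 3 → Fin 3 → ℂ := fun l m n => y (l, m, n) - α l - β m - γ n
  fun s =>
    (![Fin.snoc (fun (i l : Fin 3) => r l i i) α,
      Fin.snoc (fun i m => if m = i then 0 else r i m i) β,
      Fin.snoc (fun i n => if n = i then 0 else r i i n) γ] : Fin 3 → Fin 4 → Fin 3 → ℂ)
      s.1 s.2.1 s.2.2

/-- One coordinate has to be left out: on the image of the derivative, the coordinates at even
permutations of (0, 1, 2) and those at odd ones have the same sum. -/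
lemma segreSumDeriv_derivSection (y : Fin 3 × (Fin 3 × Fin 3) → ℂ)
    (s : Fin 3 × (Fin 3 × Fin 3)) (hs : s ≠ (0, 1, 2)) :
    segreSumDeriv (derivSection y) s = y s := by
  have h3 : ∀ (f : Fin 3 → Fin 3 → ℂ) (g : Fin 3 → ℂ),
      (Fin.snoc f g : Fin 4 → Fin 3 → ℂ) = ![f 0, f 1, f 2, g] := by
    intro f g
    ext i
    fin_cases i <;> rfl
  obtain ⟨l, m, n⟩ := s
  have e3 : (3 : Fin 4) ≠ 0 ∧ (3 : Fin 4) ≠ 1 ∧ (3 : Fin 4) ≠ 2 := by decide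
  simp only [segreSumDeriv, derivSection, h3, ContinuousLinearMap.pi_apply, Fin.sum_univ_four,
    add_apply, smul_apply, ContinuousLinearMap.proj_apply,
    smul_eq_mul]
  fin_cases l <;> fin_cases m <;> fin_cases n <;>
    first
    | exact absurd rfl hs
    | (simp [basePoint]; try ring)

/-- No nonzero polynomial in the coordinates other than `(0, 1, 2)` vanishes on the sums of four
rank one tensors. -/
lemma eq_zero_of_segreSumHom_rename_eq_zero
    {g : MvPolynomial {t : Fin 3 × (Fin 3 × Fin 3) // t ≠ (0, 1, 2)} ℂ}
    (hg : segreSumHom (rename Subtype.val g) = 0) : g = 0 := by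
  classical
  let π : (Fin 3 × (Fin 3 × Fin 3) → ℂ) →L[ℂ] ({t : Fin 3 × (Fin 3 × Fin 3) // t ≠ (0, 1, 2)} → ℂ) :=
    ContinuousLinearMap.pi fun t => ContinuousLinearMap.proj t.1
  have hd : HasStrictFDerivAt (fun θ => π (segreSum θ)) (π.comp segreSumDeriv) basePoint :=
    π.hasStrictFDerivAt.comp basePoint hasStrictFDerivAt_segreSum
  have hsurj : (π.comp segreSumDeriv).range = ⊤ := by
    refine LinearMap.range_eq_top.2 fun y => ?_
    refine ⟨derivSection fun t => if h : t ≠ (0, 1, 2) then y ⟨t, h⟩ else 0, ?_⟩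
    ext t
    change segreSumDeriv _ t.1 = y t
    rw [segreSumDeriv_derivSection _ _ t.2, dif_pos t.2]
  -- A surjective strict derivative makes the map open at the base point, so g vanishes on a full
  -- neighbourhood.
  have hmap := hd.map_nhds_eq_of_surj hsurj
  refine eq_zero_of_eventually_eval_eq_zero (x := π (segreSum basePoint)) ?_
  rw [← hmap, eventually_map]
  refine Eventually.of_forall fun θ => ?_
  have := segreSumHom_eq_zero_iff.1 hg θ
  rwa [eval_rename] at this

end Dominance

/-! ### The order of Strassen's equation at a rank one tensor. -/

section Order

open MvPolynomial

lemma eval_translate {σ : Type*} (x y : σ → ℂ) (f : MvPolynomial σ ℂ) :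
    eval y (translate x f) = eval (y + x) f := by
  induction f using MvPolynomial.induction_on with
  | C a => simp [translate]
  | add p q hp hq =>
    simp only [translate, map_add] at hp hq ⊢
    rw [hp, hq]
  | mul_X p s hp =>
    rw [translate_mul, map_mul, hp, map_mul]
    simp [translate]

lemma eval_smul_of_isHomogeneous {σ : Type*} [Fintype σ] {φ : MvPolynomial σ ℂ} {n : ℕ}
    (hφ : φ.IsHomogeneous n) (t : ℂ) (y : σ → ℂ) : eval (t • y) φ = t ^ n * eval y φ := by
  rw [eval_eq', eval_eq', Finset.mul_sum]
  refine Finset.sum_congr rfl fun d hd => ?_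
  have hdeg : ∑ i, d i = n := by
    rw [← Finsupp.degree_eq_sum, Finsupp.degree_eq_weight_one]
    exact hφ (mem_support_iff.1 hd)
  simp only [Pi.smul_apply, smul_eq_mul, mul_pow, Finset.prod_mul_distrib,
    Finset.prod_pow_eq_pow_sum, hdeg]
  ring

/-- Along the line x + t y, the coefficient of tⁿ is the value at y of the degree n component of the
Taylor expansion at x. -/
lemma homogeneousComponent_translate_ne_zero {σ : Type*} [Fintype σ] {f : MvPolynomial σ ℂ}
    {x y : σ → ℂ} {P : Polynomial ℂ} (hP : ∀ t : ℂ, eval (x + t • y) f = P.eval t) {n : ℕ}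
    (hn : P.coeff n ≠ 0) : homogeneousComponent n (translate x f) ≠ 0 := by
  intro h0
  apply hn
  have hPQ : P = ∑ j ∈ Finset.range ((translate x f).totalDegree + 1),
      Polynomial.monomial j (eval y (homogeneousComponent j (translate x f))) := by
    refine Polynomial.funext fun t => ?_
    rw [← hP, add_comm, ← eval_translate]
    nth_rw 1 [← sum_homogeneousComponent (translate x f)]
    rw [map_sum, Polynomial.eval_finsetSum]
    refine Finset.sum_congr rfl fun j _ => ?_
    rw [eval_smul_of_isHomogeneous (homogeneousComponent_isHomogeneous _ _),
      Polynomial.eval_monomial, mul_comm]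
  rw [hPQ, Polynomial.finsetSum_coeff]
  refine Finset.sum_eq_zero fun j _ => ?_
  rw [Polynomial.coeff_monomial]
  split_ifs with hj
  · rw [hj, h0, map_zero]
  · rfl

/-- Strassen's equation of the fourth secant variety. -/
noncomputable def strassen : MvPolynomial (Fin 3 × (Fin 3 × Fin 3)) ℂ :=
  (koszul X).det

lemma eval_strassen (x : Fin 3 × (Fin 3 × Fin 3) → ℂ) : eval x strassen = (koszul x).det := by
  rw [strassen, RingHom.map_det]
  congr 1
  ext ⟨p, m⟩ ⟨q, n⟩
  fin_cases p <;> fin_cases q <;> simp [koszul, crossMatrix]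

lemma segreSumHom_strassen : segreSumHom strassen = 0 := by
  rw [segreSumHom_eq_zero_iff]
  intro θ
  rw [eval_strassen]
  exact det_koszul_sum_pureTensor _ _ _

lemma exists_det_ne_zero_of_ne_zero {K : Type*} [Field K] {u : Fin 3 → K} (hu : u ≠ 0) :
    ∃ g : Matrix (Fin 3) (Fin 3) K, g.det ≠ 0 ∧ ∀ i, g i 0 = u i := by
  by_cases h0 : u 0 = 0
  · by_cases h1 : u 1 = 0
    · have h2 : u 2 ≠ 0 := by
        intro h2
        apply hu
        ext i
        fin_cases i <;> assumption
      refine ⟨!![u 0, 1, 0; u 1, 0, 1; u 2, 0, 0], by simp [Matrix.det_fin_three, h2], ?_⟩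
      intro i
      fin_cases i <;> rfl
    · refine ⟨!![u 0, 1, 0; u 1, 0, 0; u 2, 0, 1], by simp [Matrix.det_fin_three, h1], ?_⟩
      intro i
      fin_cases i <;> rfl
  · refine ⟨!![u 0, 0, 0; u 1, 1, 0; u 2, 0, 1], by simp [Matrix.det_fin_three, h0], ?_⟩
    intro i
    fin_cases i <;> rfl

lemma actFst_actSnd_add_smul {R : Type*} [CommRing R] (g h k : Matrix (Fin 3) (Fin 3) R)
    (t : R) (x y : Fin 3 × (Fin 3 × Fin 3) → R) :
    actFst g (actSnd h k (x + t • y)) =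
      actFst g (actSnd h k x) + t • actFst g (actSnd h k y) := by
  ext s
  simp only [actFst, actSnd, Pi.add_apply, Pi.smul_apply, smul_eq_mul, mul_add,
    Finset.sum_add_distrib, Finset.mul_sum]
  congr 1
  refine Finset.sum_congr rfl fun l _ => Finset.sum_congr rfl fun m _ =>
    Finset.sum_congr rfl fun n _ => ?_
  ring

lemma actFst_actSnd_single {R : Type*} [CommRing R] (g h k : Matrix (Fin 3) (Fin 3) R) :
    actFst g (actSnd h k (pureTensor (Pi.single 0 1) (Pi.single 0 1) (Pi.single 0 1))) =
      pureTensor (fun i => g i 0) (fun i => h i 0) (fun i => k i 0) := by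
  ext s
  simp [actFst, actSnd, pureTensor, Fin.sum_univ_three, mul_assoc]

/-- Invertible matrices with first columns u, v, w carry e₀ ⊗ e₀ ⊗ e₀ to the given tensor and scale
the determinant by a nonzero constant, so the image of `testDirection` detects degree seven. -/
lemma homogeneousComponent_translate_strassen_ne_zero {u v w : Fin 3 → ℂ}
    (hx : pureTensor u v w ≠ 0) :
    homogeneousComponent 7 (translate (pureTensor u v w) strassen) ≠ 0 := by
  have hu : u ≠ 0 := by
    rintro rfl
    exact hx (by ext s; simp [pureTensor])
  have hv : v ≠ 0 := by
    rintro rfl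
    exact hx (by ext s; simp [pureTensor])
  have hw : w ≠ 0 := by
    rintro rfl
    exact hx (by ext s; simp [pureTensor])
  obtain ⟨g, hg, hgu⟩ := exists_det_ne_zero_of_ne_zero hu
  obtain ⟨h, hh, hhv⟩ := exists_det_ne_zero_of_ne_zero hv
  obtain ⟨k, hk, hkw⟩ := exists_det_ne_zero_of_ne_zero hw
  have hxe := actFst_actSnd_single g h k
  simp only [hgu, hhv, hkw] at hxe
  refine homogeneousComponent_translate_ne_zero (y := actFst g (actSnd h k testDirection))
    (P := Polynomial.C (g.det ^ 3 * (h.det ^ 3 * k.det ^ 3)) *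
      (Polynomial.X ^ 7 * (Polynomial.X - Polynomial.C 1))) (fun t => ?_) ?_
  · rw [← hxe, ← actFst_actSnd_add_smul, eval_strassen, det_koszul_actFst hg, det_koszul_actSnd,
      det_koszul_add_smul_testDirection]
    simp
    ring
  · rw [Polynomial.coeff_C_mul, Polynomial.coeff_X_pow_mul']
    simp [hg, hh, hk]

end Order

/-! ### From Strassen's equation to the generator of the ideal. -/

section Multiplicity

open MvPolynomial

lemma exists_homogeneousComponent_ne_zero_of_mul {σ R : Type*} [CommRing R]
    {φ ψ : MvPolynomial σ R} {n : ℕ} (h : homogeneousComponent n (φ * ψ) ≠ 0) :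
    ∃ k ≤ n, (∀ j < k, homogeneousComponent j φ = 0) ∧ homogeneousComponent k φ ≠ 0 := by
  classical
  have hex : ∃ k, k ≤ n ∧ homogeneousComponent k φ ≠ 0 := by
    by_contra! hall
    exact h (homogeneousComponent_mul_eq_zero (k := n + 1)
      (fun j hj => hall j (by omega)) n.lt_succ_self)
  refine ⟨Nat.find hex, (Nat.find_spec hex).1, fun j hj => ?_, (Nat.find_spec hex).2⟩
  by_contra hne
  exact Nat.find_min hex hj ⟨hj.le.trans (Nat.find_spec hex).1, hne⟩

variable {A B C : Type*} [AddCommGroup A] [Module ℂ A] [AddCommGroup B] [Module ℂ B]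
    [AddCommGroup C] [Module ℂ C]
    (a : Module.Basis (Fin 3) ℂ A) (b : Module.Basis (Fin 3) ℂ B) (c : Module.Basis (Fin 3) ℂ C)

lemma exists_idealOf_secantVariety_eq_span :
    ∃ F, idealOf (a.tensorProduct (b.tensorProduct c))
      (secantVariety (a.tensorProduct (b.tensorProduct c)) (segre A B C) 4) =
        Ideal.span {F} := by
  refine exists_eq_span_singleton_of_forall_rename_mem (0, 1, 2)
    (idealOf_secantVariety_isPrime a b c) (fun h => ?_) fun r hr => ?_
  -- Strassen's equation lies in the ideal and is nonzero, having a nonzero Taylor component at some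
  -- point.
  · have hmem := (mem_idealOf_secantVariety_iff a b c).2 segreSumHom_strassen
    rw [h, Ideal.mem_bot] at hmem
    have h1 : pureTensor (fun _ => 1) (fun _ => 1) (fun _ => (1 : ℂ)) ≠ 0 := fun h0 => by
      simpa [pureTensor] using congrFun h0 (0, 0, 0)
    apply homogeneousComponent_translate_strassen_ne_zero h1
    rw [hmem]
    simp [translate]
  · exact eq_zero_of_segreSumHom_rename_eq_zero ((mem_idealOf_secantVariety_iff a b c).1 hr)

lemma exists_repr_rep_eq_pureTensor {z : ℙ ℂ (A ⊗[ℂ] (B ⊗[ℂ] C))} (hz : z ∈ segre A B C) :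
    ∃ u v w : Fin 3 → ℂ, pureTensor u v w ≠ 0 ∧
      (fun s => (a.tensorProduct (b.tensorProduct c)).repr z.rep s) = pureTensor u v w := by
  obtain ⟨p, q, r, hne, rfl⟩ := hz
  obtain ⟨t, ht⟩ := Projectivization.exists_smul_eq_mk_rep ℂ _ hne
  have hrep : (fun s => (a.tensorProduct (b.tensorProduct c)).repr
      (Projectivization.mk ℂ _ hne).rep s) =
      pureTensor (a.repr ((t : ℂ) • p)) (b.repr q) (c.repr r) := by
    rw [← repr_tmul, ← ht, Units.smul_def, TensorProduct.smul_tmul']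
  refine ⟨_, _, _, ?_, hrep⟩
  rw [← hrep]
  intro h
  apply (Projectivization.mk ℂ _ hne).rep_nonzero
  rw [← LinearEquiv.map_eq_zero_iff (a.tensorProduct (b.tensorProduct c)).repr]
  exact Finsupp.ext fun s => congrFun h s

end Multiplicity

end SecantMult

theorem mainTheorem8 {A B C : Type*} [AddCommGroup A] [Module ℂ A] [AddCommGroup B] [Module ℂ B]
    [AddCommGroup C] [Module ℂ C]
    (a : Module.Basis (Fin 3) ℂ A) (b : Module.Basis (Fin 3) ℂ B) (c : Module.Basis (Fin 3) ℂ C)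
    (z : ℙ ℂ (A ⊗[ℂ] (B ⊗[ℂ] C))) (hz : z ∈ SecantMult.segre A B C) :
    ∃ m : ℕ, m ≤ 7 ∧
      SecantMult.HasMultiplicity (a.tensorProduct (b.tensorProduct c))
        (SecantMult.secantVariety (a.tensorProduct (b.tensorProduct c))
          (SecantMult.segre A B C) 4) z m := by
  open SecantMult MvPolynomial in
  obtain ⟨F, hF⟩ := exists_idealOf_secantVariety_eq_span a b c
  obtain ⟨u, v, w, hx, hrep⟩ := exists_repr_rep_eq_pureTensor a b c hz
  have hstrassen := (mem_idealOf_secantVariety_iff a b c).2 segreSumHom_strassen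
  rw [hF, Ideal.mem_span_singleton] at hstrassen
  obtain ⟨H, hH⟩ := hstrassen
  have h7 := homogeneousComponent_translate_strassen_ne_zero hx
  rw [hH, translate_mul] at h7
  obtain ⟨k, hk7, hlow, hk⟩ := exists_homogeneousComponent_ne_zero_of_mul h7
  -- Needed to exclude k = 0, where the lowest form would be a unit. The point z is a sum of four
  -- rank one tensors, three of them zero.
  have hFz : eval (pureTensor u v w) F = 0 := by
    have hmem := (mem_idealOf_secantVariety_iff a b c).1 (hF ▸ Ideal.mem_span_singleton_self F)
    have := segreSumHom_eq_zero_iff.1 hmem fun s =>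
      if s.2.1 = 0 then (![u, v, w] : Fin 3 → Fin 3 → ℂ) s.1 s.2.2 else 0
    rw [show pureTensor u v w = segreSum _ from ?_]
    · exact this
    · ext s
      simp [segreSum_apply, pureTensor]
  have hk0 : 0 < k := by
    rw [Nat.pos_iff_ne_zero]
    rintro rfl
    apply hk
    rw [homogeneousComponent_zero, ← constantCoeff_eq, ← eval_zero, eval_translate, zero_add, hFz,
      C_0]
  refine ⟨k, hk7, ?_⟩
  rw [← hrep] at hlow hk
  rw [HasMultiplicity, tangentConeIdeal_eq_span hF hlow hk]
  -- There are 27 = n + 2 coordinates.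
  exact hasDegree_span_singleton (n := 25) (by simp) (homogeneousComponent_isHomogeneous _ _) hk hk0
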